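/- For $d\in\mathbb{N}$ and a function $\psi:\mathbb{N}\to[0,\infty)$, where $\mathbb{N}=\{1,2,\dots\}$, let $\mathcal{W}_d(\psi)$ be the set of all $\boldsymbol{x}\in\mathbb{R}^d$ such that the inequality $\|q\boldsymbol{x}-\boldsymbol{p}\|_\infty<\psi(q)$ holds for infinitely many $(\boldsymbol{p},q)\in\mathbb{Z}^d\times\mathbb{N}$. Let $d\ge 3$ and let $\psi(q)=(q\log q)^{-1/d}$ for $q\ge 2$ and $\psi(1)=0$ (the value at $q=1$ does not affect $\mathcal{W}_d(\psi)$). Then for every $x\in\mathbb{R}$, the point $(x,y_1,\dots,y_{d-1})$ lies in $\mathcal{W}_d(\psi)$ for almost every $(y_1,\dots,y_{d-1})\in\mathbb{R}^{d-1}$ with respect to $(d-1)$-dimensional Lebesgue measure; that is, $\mathcal{W}_d(\psi)\cap(\{x\}\times\mathbb{R}^{d-1})$ has full Lebesgue measure in the fiber $\{x\}\times\mathbb{R}^{d-1}$. -/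

import Mathlib

/-- The set `𝒲_d(ψ)` of `ψ`-approximable vectors: those `x ∈ ℝ^d` for which `‖q x - p‖_∞ < ψ(q)`
holds for infinitely many `(p, q) ∈ ℤ^d × ℕ` with `q ≥ 1`.
The norm on `Fin d → ℝ` is the sup norm. -/
def approximableVectors (d : ℕ) (ψ : ℕ → ℝ) : Set (Fin d → ℝ) :=
  {x | {pq : (Fin d → ℤ) × ℕ |
    1 ≤ pq.2 ∧ ‖(pq.2 : ℝ) • x - (fun i => (pq.1 i : ℝ))‖ < ψ pq.2}.Infinite}

/-- The function `ψ(q) = (q log q)^{-1/d}`. The expression is meaningful for `q ≥ 2`; for `q ≤ 1`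
and `d ≥ 1` the value here is `0`. Each single `q` contributes only finitely many `p`, so the value
at `q = 1` has no effect on the set `𝒲_d(ψ)`. -/
noncomputable def prototypePsi (d : ℕ) (q : ℕ) : ℝ :=
  ((q : ℝ) * Real.log q) ^ (-(1 : ℝ) / d)

/-- The point `(x, y_1, …, y_{d-1})` of the fiber `{x} × ℝ^{d-1} ⊆ ℝ^d`. -/
def fiberPoint {d : ℕ} (x : ℝ) (y : Fin (d - 1) → ℝ) : Fin d → ℝ :=
  fun i => if h : i.val = 0 then x else y ⟨i.val - 1, by have := i.isLt; omega⟩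

/-! Fix `x` and let `A` be the set of `q ≥ 2` for which `q x` is within `ψ q` of an integer. On the
fiber it suffices to approximate `y` in dimension `k = d - 1` with denominators from `A`. Since `k ≥
2`, Gallagher's theorem (`ae_frequently_approximable`) needs no monotonicity, so it applies to the
irregular set `A` once `∑_{q ∈ A} ψ(q)^(d-1)` diverges.

Divergence holds for every `x`: by pigeonhole, `A` has at least about `N ψ(N) / 2` elements up to
`N`. Dyadic summation by parts then bounds the series below by a multiple of `∑ 2^j ψ(2^j)^d`, which
is harmonic, up to a bounded error (`not_summable_goodDenominators`).

Gallagher's theorem combines three facts. Balls around primitive fractions with distinct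
denominators are pairwise quasi-independent, because coinciding centres are excluded, and for `k ≥
2` primitive vectors have proportion at least `1/4`. The second moment method then gives a limsup
set of positive measure. Finally, positive measure improves to full measure by a zero-one law. -/

open MeasureTheory Filter Set Metric Topology
open scoped Pointwise

/-! ### Second moment method and divergence Borel–Cantelli. -/

/-- Second moment bound: a finite family of pairwise quasi-independent sets of total measure at
least `1` covers a set of measure at least `1 / (C + 1)`. -/
theorem one_le_mul_measureReal_biUnion {α : Type*} [MeasurableSpace α] (μ : Measure α)
    [IsFiniteMeasure μ] {E : ℕ → Set α} (hE : ∀ q, MeasurableSet (E q)) {C : ℝ} (hC : 0 ≤ C)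
    (hq : ∀ q r, q ≠ r → μ.real (E q ∩ E r) ≤ C * (μ.real (E q) * μ.real (E r)))
    (s : Finset ℕ) (hs : 1 ≤ ∑ q ∈ s, μ.real (E q)) :
    1 ≤ (C + 1) * μ.real (⋃ q ∈ s, E q) := by
  classical
  set S := ∑ q ∈ s, μ.real (E q) with hS
  set U := ⋃ q ∈ s, E q with hU
  have hUm : MeasurableSet U := Finset.measurableSet_biUnion _ fun q _ => hE q
  have hindicator : ∀ F : Set α, MeasurableSet F → Integrable (F.indicator (fun _ => (1 : ℝ))) μ :=
    fun F hF => (integrable_const 1).indicator hF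
  have hval : ∀ F : Set α, MeasurableSet F → ∫ x, F.indicator (fun _ => (1 : ℝ)) x ∂μ = μ.real F :=
    fun F hF => by simp [integral_indicator hF]
  -- With `X` the counting function of the family, `2tX - X² ≤ t² 1_U` for every `t`. As `S ≥ 1`, `∫
  -- X² ≤ C S² + S ≤ (C + 1) S²`, and this `t` is the optimal choice for that bound.
  set t := (C + 1) * S with ht
  have hpt : ∀ x, 2 * t * (∑ q ∈ s, (E q).indicator (fun _ => (1 : ℝ)) x) -
      ∑ q ∈ s, ∑ r ∈ s, (E q ∩ E r).indicator (fun _ => (1 : ℝ)) x ≤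
      t ^ 2 * U.indicator (fun _ => (1 : ℝ)) x := by
    intro x
    have h2 : ∑ q ∈ s, ∑ r ∈ s, (E q ∩ E r).indicator (fun _ => (1 : ℝ)) x =
        (∑ q ∈ s, (E q).indicator (fun _ => (1 : ℝ)) x) ^ 2 := by
      rw [sq, Finset.sum_mul_sum]
      refine Finset.sum_congr rfl fun q _ => Finset.sum_congr rfl fun r _ => ?_
      by_cases h1 : x ∈ E q <;> by_cases h2 : x ∈ E r <;> simp [h1, h2]
    rw [h2]
    by_cases hx : x ∈ U
    · rw [indicator_of_mem hx]
      nlinarith [sq_nonneg (t - ∑ q ∈ s, (E q).indicator (fun _ => (1 : ℝ)) x)]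
    · have h0 : ∑ q ∈ s, (E q).indicator (fun _ => (1 : ℝ)) x = 0 := by
        refine Finset.sum_eq_zero fun q hqs => indicator_of_notMem (fun h => hx ?_) _
        exact mem_biUnion hqs h
      rw [h0, indicator_of_notMem hx]
      simp
  have hi1 : Integrable (fun x => 2 * t * (∑ q ∈ s, (E q).indicator (fun _ => (1 : ℝ)) x)) μ :=
    (integrable_finsetSum _ fun q _ => hindicator _ (hE q)).const_mul _
  have hi2 : Integrable
      (fun x => ∑ q ∈ s, ∑ r ∈ s, (E q ∩ E r).indicator (fun _ => (1 : ℝ)) x) μ :=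
    integrable_finsetSum _ fun q _ => integrable_finsetSum _ fun r _ =>
      hindicator _ ((hE q).inter (hE r))
  have hmain := integral_mono (hi1.sub hi2) ((hindicator U hUm).const_mul (t ^ 2)) hpt
  simp only [Pi.sub_apply] at hmain
  rw [integral_sub hi1 hi2, integral_const_mul, integral_const_mul, hval U hUm,
    integral_finsetSum _ fun q _ => hindicator _ (hE q),
    integral_finsetSum _ fun q _ => integrable_finsetSum _ fun r _ =>
      hindicator _ ((hE q).inter (hE r))] at hmain
  have e1 : ∑ q ∈ s, ∫ x, (E q).indicator (fun _ => (1 : ℝ)) x ∂μ = S :=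
    Finset.sum_congr rfl fun q _ => hval _ (hE q)
  have e2 : ∑ q ∈ s, ∫ x, ∑ r ∈ s, (E q ∩ E r).indicator (fun _ => (1 : ℝ)) x ∂μ ≤
      C * S ^ 2 + S := by
    have : ∀ q ∈ s, ∫ x, ∑ r ∈ s, (E q ∩ E r).indicator (fun _ => (1 : ℝ)) x ∂μ ≤
        C * (μ.real (E q) * S) + μ.real (E q) := by
      intro q hqs
      rw [integral_finsetSum _ fun r _ => hindicator _ ((hE q).inter (hE r))]
      calc ∑ r ∈ s, ∫ x, (E q ∩ E r).indicator (fun _ => (1 : ℝ)) x ∂μ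
          ≤ ∑ r ∈ s, (C * (μ.real (E q) * μ.real (E r)) + if r = q then μ.real (E q) else 0) := by
            refine Finset.sum_le_sum fun r _ => ?_
            rw [hval _ ((hE q).inter (hE r))]
            split_ifs with h
            · subst h
              rw [inter_self]
              have : 0 ≤ C * (μ.real (E r) * μ.real (E r)) := by positivity
              linarith
            · rw [add_zero]
              exact hq q r (Ne.symm h)
        _ = _ := by
            rw [Finset.sum_add_distrib, ← Finset.mul_sum, ← Finset.mul_sum,
              Finset.sum_ite_eq' s q, if_pos hqs]
    refine (Finset.sum_le_sum this).trans (le_of_eq ?_)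
    rw [Finset.sum_add_distrib, ← Finset.mul_sum, ← Finset.sum_mul, sq]
  rw [e1] at hmain
  have h3 : 2 * t * S - (C * S ^ 2 + S) ≤ t ^ 2 * μ.real U := by linarith
  have h4 : (C + 1) * S ^ 2 * 1 ≤ (C + 1) * S ^ 2 * ((C + 1) * μ.real U) := by
    rw [ht] at h3
    nlinarith
  exact le_of_mul_le_mul_left h4 (by positivity)

/-- Divergence part of the Borel–Cantelli lemma for pairwise quasi-independent sets. -/
theorem measure_limsup_pos_of_quasiIndependent {α : Type*} [MeasurableSpace α] (μ : Measure α)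
    [IsFiniteMeasure μ] {E : ℕ → Set α} (hE : ∀ q, MeasurableSet (E q)) {C : ℝ} (hC : 0 ≤ C)
    (hq : ∀ q r, q ≠ r → μ.real (E q ∩ E r) ≤ C * (μ.real (E q) * μ.real (E r)))
    (hsum : ¬ Summable fun q => μ.real (E q)) :
    0 < μ (limsup E atTop) := by
  have htail : ∀ n, ENNReal.ofReal (1 / (C + 1)) ≤ μ (⋃ i ≥ n, E i) := by
    intro n
    have h1 : Tendsto (fun N => ∑ i ∈ Finset.range N, μ.real (E i)) atTop atTop :=
      (not_summable_iff_tendsto_nat_atTop_of_nonneg fun _ => measureReal_nonneg).1 hsum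
    obtain ⟨N, hN, hnN⟩ := ((h1.eventually_ge_atTop
      (1 + ∑ i ∈ Finset.range n, μ.real (E i))).and (eventually_ge_atTop n)).exists
    have h2 : 1 ≤ ∑ i ∈ Finset.Ico n N, μ.real (E i) := by
      rw [Finset.sum_Ico_eq_sub _ hnN]
      linarith
    have h3 := one_le_mul_measureReal_biUnion μ hE hC hq _ h2
    have h4 : 1 / (C + 1) ≤ μ.real (⋃ i ∈ Finset.Ico n N, E i) := by
      rw [div_le_iff₀ (by positivity)]
      linarith
    calc ENNReal.ofReal (1 / (C + 1)) ≤ μ (⋃ i ∈ Finset.Ico n N, E i) := by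
          rw [← ofReal_measureReal (measure_ne_top _ _)]
          exact ENNReal.ofReal_le_ofReal h4
      _ ≤ _ := by
          refine measure_mono (iUnion_mono fun i => iUnion_subset fun hi => ?_)
          exact subset_iUnion (fun _ : i ≥ n => E i) (Finset.mem_Ico.1 hi).1
  rw [limsup_eq_iInf_iSup_of_nat]
  simp only [iInf_eq_iInter, iSup_eq_iUnion]
  have hanti : Antitone fun n : ℕ => ⋃ i ≥ n, E i := fun m n hmn =>
    iUnion_mono fun i => iUnion_subset fun hi =>
      subset_iUnion (fun _ : i ≥ m => E i) (hmn.trans hi)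
  rw [hanti.measure_iInter (fun n => (MeasurableSet.iUnion fun i =>
    MeasurableSet.iUnion fun _ => hE i).nullMeasurableSet) ⟨0, measure_ne_top _ _⟩]
  exact lt_of_lt_of_le (by positivity) (le_iInf htail)

/-! ### Zero-one law. -/

/-- A measurable subset of `ℝ^k` of positive measure that is invariant under integer translations
and mapped into itself by `y ↦ 2 y` has full measure. -/
theorem ae_mem_of_int_translation_of_two_smul {k : ℕ} {S : Set (Fin k → ℝ)}
    (hS : MeasurableSet S) (htr : ∀ y ∈ S, ∀ n : Fin k → ℤ, (fun i => y i + n i) ∈ S)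
    (htwo : ∀ y ∈ S, (2 : ℝ) • y ∈ S) (hpos : volume S ≠ 0) : ∀ᵐ y, y ∈ S := by
  have hpow : ∀ j : ℕ, ∀ y ∈ S, ((2 : ℝ) ^ j) • y ∈ S := by
    intro j
    induction j with
    | zero => intro y hy; simpa using hy
    | succ j ih => intro y hy; rw [pow_succ', mul_smul]; exact htwo _ (ih y hy)
  set c : Fin k → ℝ := fun _ => 1 / 2 with hc
  set Q := closedBall c (1 / 2) with hQ
  have hQvol : volume Q = 1 := by
    rw [hQ, Real.volume_pi_closedBall _ (by norm_num)]
    norm_num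
  have hrestr : volume.restrict S ≠ 0 := by
    rwa [Ne, Measure.restrict_eq_zero]
  have : (ae (volume.restrict S)).NeBot := ae_neBot.2 hrestr
  obtain ⟨x, hx⟩ :=
    (IsUnifLocDoublingMeasure.ae_tendsto_measure_inter_div (volume : Measure (Fin k → ℝ)) S
      1).exists
  have hδ : Tendsto (fun j : ℕ => ((2 : ℝ) ^ j)⁻¹ * (1 / 2)) atTop (𝓝[>] 0) := by
    refine tendsto_nhdsWithin_iff.2 ⟨?_, Eventually.of_forall fun j => ?_⟩
    · have := tendsto_inv_atTop_zero.comp (tendsto_pow_atTop_atTop_of_one_lt (r := (2 : ℝ))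
        (by norm_num))
      rw [← zero_mul (1 / 2 : ℝ)]
      exact this.mul_const (1 / 2)
    · exact mem_Ioi.2 (by positivity)
  -- Sup-norm balls are cubes: these are the dyadic cubes of side `2^(-j)` containing the density
  -- point `x`.
  have hlim := hx (fun j i => ((2 : ℝ) ^ j)⁻¹ * (⌊2 ^ j * x i⌋ + 1 / 2)) _ hδ
    (Eventually.of_forall fun j => by
      rw [one_mul, mem_closedBall, dist_pi_le_iff (by positivity)]
      intro i
      have h1 := Int.floor_le (2 ^ j * x i)
      have h2 := Int.lt_floor_add_one (2 ^ j * x i)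
      have h3 : x i = ((2 : ℝ) ^ j)⁻¹ * (2 ^ j * x i) := by field_simp
      rw [Real.dist_eq, h3, ← mul_sub, abs_mul, abs_of_pos (by positivity)]
      rw [← h3]
      refine mul_le_mul_of_nonneg_left ?_ (by positivity)
      rw [abs_le]
      constructor <;> linarith)
  -- Dilating by `2^j` and translating by an integer vector carries the dyadic cube onto `Q` and
  -- keeps points of `S` in `S`. The density of `S` in each such cube is thus at most its density in
  -- `Q`.
  have hle : ∀ j : ℕ, volume (S ∩ closedBall
      (fun i => ((2 : ℝ) ^ j)⁻¹ * (⌊2 ^ j * x i⌋ + 1 / 2)) (((2 : ℝ) ^ j)⁻¹ * (1 / 2))) /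
      volume (closedBall (fun i => ((2 : ℝ) ^ j)⁻¹ * ((⌊2 ^ j * x i⌋ : ℝ) + 1 / 2))
        (((2 : ℝ) ^ j)⁻¹ * (1 / 2))) ≤ volume (S ∩ Q) := by
    intro j
    have hp : (0 : ℝ) < 2 ^ j := by positivity
    refine ENNReal.div_le_of_le_mul ?_
    have hsub : S ∩ closedBall (fun i => ((2 : ℝ) ^ j)⁻¹ * ((⌊2 ^ j * x i⌋ : ℝ) + 1 / 2))
        (((2 : ℝ) ^ j)⁻¹ * (1 / 2)) ⊆
        (((2 : ℝ) ^ j)⁻¹) • ((fun y => y + fun i => (⌊2 ^ j * x i⌋ : ℝ)) '' (S ∩ Q)) := by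
      rintro y ⟨hyS, hy⟩
      rw [mem_smul_set_iff_inv_smul_mem₀ (by positivity), inv_inv]
      refine ⟨(2 : ℝ) ^ j • y - fun i => (⌊2 ^ j * x i⌋ : ℝ), ⟨?_, ?_⟩, by simp⟩
      · convert htr _ (hpow j y hyS) (fun i => -⌊2 ^ j * x i⌋) using 1
        ext i
        simp [sub_eq_add_neg]
      · rw [mem_closedBall, dist_pi_le_iff (by positivity)] at hy
        rw [hQ, mem_closedBall, dist_pi_le_iff (by positivity)]
        intro i
        have h1 := hy i
        have h3 : y i = ((2 : ℝ) ^ j)⁻¹ * (2 ^ j * y i) := by field_simp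
        rw [Real.dist_eq, h3, ← mul_sub, abs_mul, abs_of_pos (by positivity)] at h1
        have h4 := le_of_mul_le_mul_left h1 (by positivity)
        rw [Real.dist_eq]
        simp only [Pi.sub_apply, Pi.smul_apply, smul_eq_mul, hc]
        rw [abs_le] at h4 ⊢
        constructor <;> linarith
    refine (measure_mono hsub).trans ?_
    rw [Measure.addHaar_smul, image_add_right, measure_preimage_add_right,
      Real.volume_pi_closedBall _ (by positivity), mul_comm]
    refine mul_le_mul_right (le_of_eq ?_) _
    congr 1
    rw [abs_of_pos (by positivity), Module.finrank_fin_fun, Fintype.card_fin]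
    ring
  have hone : (1 : ENNReal) ≤ volume (S ∩ Q) := le_of_tendsto' hlim hle
  have hdiff : volume (Q \ S) = 0 := by
    rw [inter_comm] at hone
    have h1 := measure_inter_add_sdiff (μ := volume) Q hS
    rw [hQvol] at h1
    have h2 : volume (Q ∩ S) = 1 := le_antisymm (h1 ▸ le_self_add) hone
    rw [h2] at h1
    exact (ENNReal.add_right_inj ENNReal.one_ne_top).1 (h1.trans (add_zero 1).symm)
  refine measure_mono_null (t := ⋃ n : Fin k → ℤ, (fun y => y + fun i => (n i : ℝ)) ⁻¹' (Q \ S))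
    ?_ (measure_iUnion_null fun n => by rw [measure_preimage_add_right, hdiff])
  intro y hy
  refine mem_iUnion.2 ⟨fun i => -⌊y i⌋, ?_, fun h => hy ?_⟩
  · rw [hQ, mem_closedBall, dist_pi_le_iff (by positivity)]
    intro i
    have h1 := Int.floor_le (y i)
    have h2 := Int.lt_floor_add_one (y i)
    rw [Real.dist_eq, abs_le]
    simp only [Pi.add_apply, Int.cast_neg, hc]
    constructor <;> linarith
  · have h1 := htr _ h (fun i => ⌊y i⌋)
    simpa using h1

/-! ### Counting primitive vectors and close fractions. -/

/-- The vectors `p ∈ {0, …, q - 1}^k` with `gcd(p_1, …, p_k, q) = 1`. -/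
def primitiveVectors (k q : ℕ) : Finset (Fin k → ℕ) :=
  (Fintype.piFinset fun _ => Finset.range q).filter fun p => (Finset.univ.gcd p).Coprime q

theorem mem_primitiveVectors {k q : ℕ} {p : Fin k → ℕ} :
    p ∈ primitiveVectors k q ↔ (∀ i, p i < q) ∧ (Finset.univ.gcd p).Coprime q := by
  simp [primitiveVectors, Fintype.mem_piFinset]

/-- A rational vector has a unique primitive denominator. -/
theorem eq_of_mem_primitiveVectors {k q r : ℕ} {p s : Fin k → ℕ} (hp : p ∈ primitiveVectors k q)
    (hs : s ∈ primitiveVectors k r) (h : ∀ i, p i * r = s i * q) : q = r := by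
  have key : ∀ {q r : ℕ} {p s : Fin k → ℕ}, p ∈ primitiveVectors k q →
      (∀ i, p i * r = s i * q) → q ∣ r := by
    intro q r p s hp h
    have h1 : q ∣ Finset.univ.gcd fun i => p i * r :=
      Finset.dvd_gcd fun i _ => ⟨s i, by rw [h i, mul_comm]⟩
    rw [Finset.gcd_mul_right, normalize_eq] at h1
    exact (mem_primitiveVectors.1 hp).2.symm.dvd_of_dvd_mul_left h1
  exact Nat.dvd_antisymm (key hp h) (key hs fun i => (h i).symm)

theorem sum_Icc_two_inv_sq_le (q : ℕ) : ∑ n ∈ Finset.Icc 2 q, ((n : ℝ) ^ 2)⁻¹ ≤ 3 / 4 := by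
  rcases lt_or_ge q 2 with h | h
  · rw [Finset.Icc_eq_empty (by omega)]
    norm_num
  -- The correction `-1/q` makes the induction telescope; at `q = 2` there is equality.
  · have : ∑ n ∈ Finset.Icc 2 q, ((n : ℝ) ^ 2)⁻¹ ≤ 3 / 4 - (q : ℝ)⁻¹ := by
      induction q, h using Nat.le_induction with
      | base => norm_num
      | succ q hq ih =>
        rw [Finset.sum_Icc_succ_top (by omega)]
        have hq' : (0 : ℝ) < q := by exact_mod_cast (by omega : 0 < q)
        have : (((q + 1 : ℕ) : ℝ) ^ 2)⁻¹ ≤ (q : ℝ)⁻¹ - ((q + 1 : ℕ) : ℝ)⁻¹ := by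
          push_cast
          rw [inv_sub_inv hq'.ne' (by positivity), add_sub_cancel_left, ← one_div]
          exact one_div_le_one_div_of_le (by positivity) (by nlinarith)
        linarith
    have h0 : (0 : ℝ) ≤ (q : ℝ)⁻¹ := by positivity
    linarith

/-- A non-primitive vector has all its coordinates divisible by some divisor `n ≥ 2` of `q`, leaving
`(q/n)^k ≤ q^k / n²` choices. The sum over `n` is at most `3/4 · q^k`. The exponent `2` is where `k
≥ 2` enters; for `k = 1` the proportion `φ(q)/q` has no positive lower bound. -/
theorem pow_le_four_mul_card_primitiveVectors {k q : ℕ} (hk : 2 ≤ k) (hq : 0 < q) :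
    (q : ℝ) ^ k ≤ 4 * (primitiveVectors k q).card := by
  classical
  set V : Finset (Fin k → ℕ) := Fintype.piFinset fun _ => Finset.range q with hV
  have hVc : V.card = q ^ k := by simp [hV]
  have hsplit := Finset.card_filter_add_card_filter_not (s := V)
    (fun p => (Finset.univ.gcd p).Coprime q)
  have hsub : V.filter (fun p => ¬ (Finset.univ.gcd p).Coprime q) ⊆
      ((Finset.Icc 2 q).filter (· ∣ q)).biUnion fun n =>
        Fintype.piFinset fun _ => (Finset.range (q / n)).image (n * ·) := by
    intro p hp
    rw [Finset.mem_filter, hV, Fintype.mem_piFinset] at hp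
    set g := (Finset.univ.gcd p).gcd q with hg
    have hgq : g ∣ q := Nat.gcd_dvd_right _ _
    have hg0 : 0 < g := Nat.pos_of_dvd_of_pos hgq hq
    rw [Finset.mem_biUnion]
    refine ⟨g, ?_, ?_⟩
    · rw [Finset.mem_filter, Finset.mem_Icc]
      refine ⟨⟨?_, Nat.le_of_dvd hq hgq⟩, hgq⟩
      have : g ≠ 1 := hp.2
      omega
    · rw [Fintype.mem_piFinset]
      intro i
      have hgi : g ∣ p i := (Nat.gcd_dvd_left _ _).trans (Finset.gcd_dvd (Finset.mem_univ i))
      rw [Finset.mem_image]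
      refine ⟨p i / g, ?_, Nat.mul_div_cancel' hgi⟩
      rw [Finset.mem_range]
      exact Nat.div_lt_div_of_lt_of_dvd hgq (Finset.mem_range.1 (hp.1 i))
  have hcard : ((V.filter fun p => ¬ (Finset.univ.gcd p).Coprime q).card : ℝ) ≤
      3 / 4 * (q : ℝ) ^ k := by
    have h1 : (V.filter fun p => ¬ (Finset.univ.gcd p).Coprime q).card ≤
        ∑ n ∈ (Finset.Icc 2 q).filter (· ∣ q), (q / n) ^ k := by
      refine (Finset.card_le_card hsub).trans (Finset.card_biUnion_le.trans ?_)
      refine Finset.sum_le_sum fun n _ => ?_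
      rw [Fintype.card_piFinset_const]
      simpa using Nat.pow_le_pow_left
        (Finset.card_image_le (s := Finset.range (q / n)) (f := (n * ·))) k
    calc ((V.filter fun p => ¬ (Finset.univ.gcd p).Coprime q).card : ℝ)
        ≤ ∑ n ∈ (Finset.Icc 2 q).filter (· ∣ q), (((q / n : ℕ) : ℝ)) ^ k := by exact_mod_cast h1
      _ ≤ ∑ n ∈ (Finset.Icc 2 q).filter (· ∣ q), (q : ℝ) ^ k * ((n : ℝ) ^ 2)⁻¹ := by
          refine Finset.sum_le_sum fun n hn => ?_
          have hn2 : 2 ≤ n := (Finset.mem_Icc.1 (Finset.mem_filter.1 hn).1).1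
          have hn1 : (1 : ℝ) ≤ n := by exact_mod_cast (by omega : 1 ≤ n)
          calc (((q / n : ℕ) : ℝ)) ^ k ≤ ((q : ℝ) / n) ^ k :=
                pow_le_pow_left₀ (by positivity) Nat.cast_div_le k
            _ = (q : ℝ) ^ k * ((n : ℝ) ^ k)⁻¹ := by rw [div_pow, div_eq_mul_inv]
            _ ≤ _ := by gcongr
      _ ≤ ∑ n ∈ Finset.Icc 2 q, (q : ℝ) ^ k * ((n : ℝ) ^ 2)⁻¹ :=
          Finset.sum_le_sum_of_subset_of_nonneg (Finset.filter_subset _ _)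
            fun _ _ _ => by positivity
      _ ≤ _ := by
          rw [← Finset.mul_sum, mul_comm]
          exact mul_le_mul_of_nonneg_right (sum_Icc_two_inv_sq_le q) (by positivity)
  have h2 : ((primitiveVectors k q).card : ℝ) +
      (V.filter fun p => ¬ (Finset.univ.gcd p).Coprime q).card = (q : ℝ) ^ k := by
    rw [hVc] at hsplit
    exact_mod_cast hsplit
  linarith

/-- The pairs of fractions `a / q`, `b / r` in `[0, 1)` at distance less than `D / (q r)`. -/
noncomputable def closePairs (q r : ℕ) (D : ℝ) : Finset (ℕ × ℕ) :=
  open Classical in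
  (Finset.range q ×ˢ Finset.range r).filter fun c => |(c.1 : ℝ) * r - c.2 * q| < D

/-- Write `q = g q'` and `r = g r'` with `g` the gcd. The integer `a r' - b q'` takes at most `2D/g
+ 1` values. Each value fixes `a` modulo `q'`, and `b` once `a` is known, so at most `g` pairs share
it. The total `2D + g` is at most `3D` because `g ≤ D`. -/
theorem card_closePairs_le {q r : ℕ} (hq : 0 < q) {D : ℝ} (hD : (q.gcd r : ℝ) ≤ D) :
    ((closePairs q r D).card : ℝ) ≤ 3 * D := by
  classical
  obtain ⟨q', r', hco, hq', hr'⟩ := Nat.exists_coprime q r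
  set g := q.gcd r with hg
  have hg0 : 0 < g := Nat.gcd_pos_of_pos_left _ hq
  have hq0 : 0 < q' := by
    rcases Nat.eq_zero_or_pos q' with h | h
    · rw [h] at hq'
      omega
    · exact h
  have hgR : (0 : ℝ) < g := by exact_mod_cast hg0
  have hy : 0 ≤ ⌊D / g⌋ := Int.floor_nonneg.2 (div_nonneg (hgR.le.trans hD) hgR.le)
  have hcard := Finset.card_le_mul_card_image_of_maps_to (s := closePairs q r D)
    (f := fun c : ℕ × ℕ => (c.1 : ℤ) * r' - c.2 * q') (t := Finset.Icc (-⌊D / g⌋) ⌊D / g⌋)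
    (by
      intro c hc
      have h1 := (Finset.mem_filter.1 hc).2
      have h2 : |(((c.1 : ℤ) * r' - c.2 * q' : ℤ) : ℝ)| ≤ D / g := by
        rw [le_div_iff₀ hgR]
        refine le_of_eq_of_le ?_ h1.le
        refine (congrArg _ (abs_of_pos hgR).symm).trans ((abs_mul _ _).symm.trans ?_)
        congr 1
        push_cast
        rw [hq', hr']
        push_cast
        ring
      rw [Finset.mem_Icc, ← abs_le]
      refine Int.le_floor.2 ?_
      rw [Int.cast_abs]
      exact h2) g
    (by
      intro b _
      rw [← Finset.card_range g]
      refine Finset.card_le_card_of_injOn (fun c => c.1 / q') ?_ ?_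
      · intro c hc
        have h1 := (Finset.mem_filter.1 (Finset.mem_filter.1 (Finset.mem_coe.1 hc)).1).1
        have h2 := Finset.mem_range.1 (Finset.mem_product.1 h1).1
        rw [Finset.mem_coe, Finset.mem_range, Nat.div_lt_iff_lt_mul hq0]
        rw [mul_comm]
        exact lt_of_lt_of_eq h2 (by rw [hq', mul_comm])
      · intro c hc e he hce
        have h1 := (Finset.mem_filter.1 (Finset.mem_coe.1 hc)).2
        have h2 := (Finset.mem_filter.1 (Finset.mem_coe.1 he)).2
        have h3 : (c.1 : ℤ) * r' - c.2 * q' = (e.1 : ℤ) * r' - e.2 * q' := h1.trans h2.symm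
        have h4 : (q' : ℤ) ∣ ((c.1 : ℤ) - e.1) * r' := ⟨c.2 - e.2, by linear_combination h3⟩
        have h5 : (q' : ℤ) ∣ (c.1 : ℤ) - e.1 :=
          (Nat.isCoprime_iff_coprime.2 hco).dvd_of_dvd_mul_right h4
        have h6 : e.1 ≡ c.1 [MOD q'] := (Nat.modEq_iff_dvd).2 h5
        have h7 : c.1 = e.1 := by
          have hce' : c.1 / q' = e.1 / q' := hce
          rw [← Nat.div_add_mod c.1 q', ← Nat.div_add_mod e.1 q', hce', h6]
        refine Prod.ext h7 ?_
        rw [h7] at h3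
        have h8 : (c.2 : ℤ) * q' = e.2 * q' := by linarith
        exact_mod_cast mul_right_cancel₀ (by exact_mod_cast hq0.ne') h8)
  rw [Int.card_Icc] at hcard
  have h1 : ((⌊D / g⌋ + 1 - -⌊D / g⌋).toNat : ℝ) ≤ 2 * (D / g) + 1 := by
    have h2 : (((⌊D / g⌋ + 1 - -⌊D / g⌋).toNat : ℤ) : ℝ) = 2 * (⌊D / g⌋ : ℝ) + 1 := by
      rw [Int.toNat_of_nonneg (by omega)]
      push_cast
      ring
    have h3 := Int.floor_le (D / g)
    rw [Int.cast_natCast] at h2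
    linarith
  calc ((closePairs q r D).card : ℝ) ≤ g * ((⌊D / g⌋ + 1 - -⌊D / g⌋).toNat : ℝ) := by
        exact_mod_cast hcard
    _ ≤ g * (2 * (D / g) + 1) := mul_le_mul_of_nonneg_left h1 hgR.le
    _ = 2 * D + g := by field_simp
    _ ≤ 3 * D := by linarith

/-! ### Volumes of primitive neighbourhoods and of their intersections. -/

/-- The points within `ρ` of a primitive fraction with denominator `q`. -/
def primitiveNeighbourhood (k q : ℕ) (ρ : ℝ) : Set (Fin k → ℝ) :=
  ⋃ p ∈ primitiveVectors k q, ball (fun i => (p i : ℝ) / q) ρ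

theorem measurableSet_primitiveNeighbourhood (k q : ℕ) (ρ : ℝ) :
    MeasurableSet (primitiveNeighbourhood k q ρ) :=
  Finset.measurableSet_biUnion _ fun _ _ => measurableSet_ball

/-- The intersection is covered by balls of the smaller radius `σ`, one for each pair of centres
closer than `ρ + σ` in every coordinate. There are at most `(3D)^k` such pairs, and `ρ + σ ≤ 2ρ`
yields the constant `3 · 2 · 2 = 12`. -/
theorem volume_inter_primitiveNeighbourhood_le_of_le {k q r : ℕ} (hq : 0 < q) (hr : 0 < r)
    (hqr : q ≠ r) {ρ σ : ℝ} (hσ : 0 < σ) (hσρ : σ ≤ ρ) :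
    volume (primitiveNeighbourhood k q ρ ∩ primitiveNeighbourhood k r σ) ≤
      ENNReal.ofReal ((12 * (q * ρ) * (r * σ)) ^ k) := by
  classical
  have hqR : (0 : ℝ) < q := by exact_mod_cast hq
  have hrR : (0 : ℝ) < r := by exact_mod_cast hr
  set D : ℝ := q * r * (ρ + σ) with hD
  have hD0 : 0 ≤ D := by
    have : 0 ≤ ρ := hσ.le.trans hσρ
    positivity
  set T := (primitiveVectors k q ×ˢ primitiveVectors k r).filter
    fun c => ∀ i, |(c.1 i : ℝ) * r - c.2 i * q| < D with hT
  have hsub : primitiveNeighbourhood k q ρ ∩ primitiveNeighbourhood k r σ ⊆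
      ⋃ c ∈ T, ball (fun i => (c.2 i : ℝ) / r) σ := by
    rintro y ⟨h1, h2⟩
    simp only [primitiveNeighbourhood, mem_iUnion] at h1 h2
    obtain ⟨p, hp, h1⟩ := h1
    obtain ⟨s, hs, h2⟩ := h2
    simp only [mem_iUnion]
    refine ⟨(p, s), ?_, h2⟩
    rw [hT, Finset.mem_filter]
    refine ⟨Finset.mk_mem_product hp hs, fun i => ?_⟩
    have h3 : dist ((p i : ℝ) / q) ((s i : ℝ) / r) < ρ + σ := by
      have h4 := (dist_le_pi_dist y (fun i => (p i : ℝ) / q) i).trans_lt h1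
      have h5 := (dist_le_pi_dist y (fun i => (s i : ℝ) / r) i).trans_lt h2
      rw [dist_comm] at h4
      exact (dist_triangle _ (y i) _).trans_lt (add_lt_add h4 h5)
    have h6 : (p i : ℝ) * r - s i * q = (q * r) * ((p i : ℝ) / q - (s i : ℝ) / r) := by
      field_simp
    rw [h6, abs_mul, abs_of_pos (by positivity), hD]
    exact mul_lt_mul_of_pos_left h3 (by positivity)
  have hTcard : (T.card : ℝ) ≤ (3 * D) ^ k := by
    -- Below the gcd the coordinate count fails, since coinciding fractions survive. Here `p_i r -
    -- s_i q` is a multiple of the gcd smaller than it, hence zero, and primitivity would force `q =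
    -- r`.
    rcases lt_or_ge D (q.gcd r : ℝ) with hlt | hge
    · have : T = ∅ := by
        refine Finset.eq_empty_of_forall_notMem fun c hc => hqr ?_
        rw [hT, Finset.mem_filter, Finset.mem_product] at hc
        refine eq_of_mem_primitiveVectors hc.1.1 hc.1.2 fun i => ?_
        have h1 : ((q.gcd r : ℕ) : ℤ) ∣ (c.1 i : ℤ) * r - c.2 i * q :=
          dvd_sub (Dvd.dvd.mul_left (by exact_mod_cast Nat.gcd_dvd_right q r) _)
            (Dvd.dvd.mul_left (by exact_mod_cast Nat.gcd_dvd_left q r) _)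
        have h2 : |(c.1 i : ℤ) * r - c.2 i * q| < (q.gcd r : ℕ) := by
          have h3 := (hc.2 i).trans hlt
          exact_mod_cast h3
        have h4 := Int.eq_zero_of_abs_lt_dvd h1 h2
        have h5 : (c.1 i : ℤ) * r = c.2 i * q := by linarith
        exact_mod_cast h5
      rw [this]
      simp only [Finset.card_empty, Nat.cast_zero]
      positivity
    · have h1 : T.card ≤ (closePairs q r D).card ^ k := by
        have h2 : T.card ≤ (Fintype.piFinset fun _ : Fin k => closePairs q r D).card := by
          refine Finset.card_le_card_of_injOn (fun c i => (c.1 i, c.2 i)) ?_ ?_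
          · intro c hc
            rw [Finset.mem_coe, hT, Finset.mem_filter, Finset.mem_product] at hc
            rw [Finset.mem_coe, Fintype.mem_piFinset]
            intro i
            rw [closePairs, Finset.mem_filter]
            exact ⟨Finset.mk_mem_product
              (Finset.mem_range.2 ((mem_primitiveVectors.1 hc.1.1).1 i))
              (Finset.mem_range.2 ((mem_primitiveVectors.1 hc.1.2).1 i)), hc.2 i⟩
          · intro c _ e _ hce
            refine Prod.ext (funext fun i => ?_) (funext fun i => ?_)
            · exact congrArg Prod.fst (congrFun hce i)
            · exact congrArg Prod.snd (congrFun hce i)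
        simpa [Fintype.card_piFinset_const] using h2
      calc (T.card : ℝ) ≤ ((closePairs q r D).card : ℝ) ^ k := by exact_mod_cast h1
        _ ≤ _ := pow_le_pow_left₀ (by positivity) (card_closePairs_le hq hge) k
  calc volume (primitiveNeighbourhood k q ρ ∩ primitiveNeighbourhood k r σ)
      ≤ ∑ c ∈ T, volume (ball (fun i => (c.2 i : ℝ) / r) σ) :=
        (measure_mono hsub).trans (measure_biUnion_finset_le _ _)
    _ = T.card * ENNReal.ofReal ((2 * σ) ^ k) := by
        simp [Real.volume_pi_ball _ hσ]
    _ = ENNReal.ofReal (T.card * (2 * σ) ^ k) := by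
        rw [ENNReal.ofReal_mul (by positivity), ENNReal.ofReal_natCast]
    _ ≤ _ := by
        refine ENNReal.ofReal_le_ofReal ?_
        calc (T.card : ℝ) * (2 * σ) ^ k ≤ (3 * D) ^ k * (2 * σ) ^ k :=
              mul_le_mul_of_nonneg_right hTcard (by positivity)
          _ = (3 * D * (2 * σ)) ^ k := (mul_pow _ _ _).symm
          _ ≤ _ := by
              refine pow_le_pow_left₀ (by positivity) ?_ k
              have : q * r * σ * (ρ + σ) ≤ q * r * σ * (2 * ρ) :=
                mul_le_mul_of_nonneg_left (by linarith) (by positivity)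
              rw [hD]
              linarith

theorem volume_inter_primitiveNeighbourhood_le {k q r : ℕ} (hq : 0 < q) (hr : 0 < r)
    (hqr : q ≠ r) {ρ σ : ℝ} (hρ : 0 < ρ) (hσ : 0 < σ) :
    volume (primitiveNeighbourhood k q ρ ∩ primitiveNeighbourhood k r σ) ≤
      ENNReal.ofReal ((12 * (q * ρ) * (r * σ)) ^ k) := by
  rcases le_total σ ρ with h | h
  · exact volume_inter_primitiveNeighbourhood_le_of_le hq hr hqr hσ h
  · rw [inter_comm, mul_right_comm]
    exact volume_inter_primitiveNeighbourhood_le_of_le hr hq hqr.symm hρ h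

/-- Distinct centres are at least `1/q ≥ 2ρ` apart, so the balls are disjoint and their volumes add.
-/
theorem le_volume_primitiveNeighbourhood {k q : ℕ} (hk : 2 ≤ k) (hq : 0 < q) {ρ : ℝ}
    (hρ : 0 < ρ) (hρq : 2 * ρ ≤ 1 / q) :
    ENNReal.ofReal ((2 * (q * ρ)) ^ k / 4) ≤ volume (primitiveNeighbourhood k q ρ) := by
  have hqR : (0 : ℝ) < q := by exact_mod_cast hq
  have hdisj : (primitiveVectors k q : Set (Fin k → ℕ)).PairwiseDisjoint
      fun p => ball (fun i => (p i : ℝ) / q) ρ := by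
    intro p _ s _ hps
    refine ball_disjoint_ball ?_
    obtain ⟨i, hi⟩ := Function.ne_iff.1 hps
    have h1 : (1 : ℝ) ≤ |(p i : ℝ) - s i| := by
      have : (1 : ℤ) ≤ |(p i : ℤ) - s i| := by
        rw [← Int.zero_add 1]
        exact Int.add_one_le_iff.2 (abs_pos.2 (sub_ne_zero.2 (by exact_mod_cast hi)))
      exact_mod_cast this
    calc ρ + ρ ≤ 1 / q := by linarith
      _ ≤ |(p i : ℝ) - s i| / q := by gcongr
      _ = dist ((p i : ℝ) / q) ((s i : ℝ) / q) := by
          rw [Real.dist_eq, ← sub_div, abs_div, abs_of_pos hqR]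
      _ ≤ _ := dist_le_pi_dist (fun i => (p i : ℝ) / q) (fun i => (s i : ℝ) / q) i
  rw [primitiveNeighbourhood, measure_biUnion_finset hdisj fun _ _ => measurableSet_ball]
  simp only [Real.volume_pi_ball _ hρ, Finset.sum_const, nsmul_eq_mul, Fintype.card_fin]
  rw [← ENNReal.ofReal_natCast, ← ENNReal.ofReal_mul (by positivity)]
  refine ENNReal.ofReal_le_ofReal ?_
  have h1 := pow_le_four_mul_card_primitiveVectors hk hq
  have h2 : (2 * (q * ρ)) ^ k = (q : ℝ) ^ k * (2 * ρ) ^ k := by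
    rw [← mul_pow]
    congr 1
    ring
  rw [h2]
  have h3 : (0 : ℝ) ≤ (2 * ρ) ^ k := by positivity
  nlinarith

/-! ### Gallagher's theorem along a set of denominators. -/

theorem mem_blimsup_iff_frequently {α : Type*} {s : ℕ → Set α} {P : ℕ → Prop} {a : α} :
    a ∈ blimsup s atTop P ↔ ∃ᶠ q in atTop, P q ∧ a ∈ s q := by
  rw [blimsup_eq_limsup, mem_limsup_iff_frequently_mem, frequently_inf_principal]
  rfl

/-- The rational vectors with denominator `q`. -/
def rationalGrid (k q : ℕ) : Set (Fin k → ℝ) :=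
  range fun (p : Fin k → ℤ) i => (p i : ℝ) / q

theorem mem_thickening_rationalGrid {k q : ℕ} (hq : 0 < q) {c t : ℝ} (hct : 0 < c * t)
    {y : Fin k → ℝ} :
    y ∈ thickening (c * (t / q)) (rationalGrid k q) ↔
      ∃ p : Fin k → ℤ, ∀ i, |q * y i - p i| < c * t := by
  have hqR : (0 : ℝ) < q := by exact_mod_cast hq
  rw [mem_thickening_iff, rationalGrid, exists_range_iff]
  refine exists_congr fun p => ?_
  rw [dist_pi_lt_iff (by rw [← mul_div_assoc]; positivity)]
  refine forall_congr' fun i => ?_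
  have h : |q * y i - p i| = q * |y i - p i / q| := by
    rw [← abs_of_pos hqR, ← abs_mul, abs_of_pos hqR]
    congr 1
    field_simp
  rw [Real.dist_eq, h, ← mul_div_assoc, lt_div_iff₀ hqR, mul_comm]

/-- The primitive neighbourhoods with denominators in `A` have a limsup set of positive measure as
soon as the approximation series diverges along `A`. -/
theorem volume_limsup_primitiveNeighbourhood_ne_zero {k : ℕ} (hk : 2 ≤ k) {A : Set ℕ}
    {ψ : ℕ → ℝ} (hA : ∀ q ∈ A, 0 < q) (hpos : ∀ q ∈ A, 0 < ψ q) (hψ : ∀ q, |ψ q| ≤ 1)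
    (hdiv : ¬ Summable (A.indicator fun q => ψ q ^ k)) :
    volume {y : Fin k → ℝ | ∃ᶠ q in atTop,
      q ∈ A ∧ y ∈ primitiveNeighbourhood k q (ψ q / (2 * q))} ≠ 0 := by
  classical
  -- Halving the radius makes the balls for each `q` disjoint, since `ψ ≤ 1`.
  set E : ℕ → Set (Fin k → ℝ) := fun q =>
    if q ∈ A then primitiveNeighbourhood k q (ψ q / (2 * q)) else ∅ with hE
  have hEA : ∀ q ∈ A, E q = primitiveNeighbourhood k q (ψ q / (2 * q)) := fun q hq => if_pos hq
  have hEA' : ∀ q, q ∉ A → E q = ∅ := fun q hq => if_neg hq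
  have hρ : ∀ q ∈ A, 0 < ψ q / (2 * q) := fun q hq => by
    have h1 := hpos q hq
    have h2 : (0 : ℝ) < q := by exact_mod_cast hA q hq
    positivity
  have hqρ : ∀ q ∈ A, (q : ℝ) * (ψ q / (2 * q)) = ψ q / 2 := fun q hq => by
    have h2 : (0 : ℝ) < q := by exact_mod_cast hA q hq
    field_simp
  have hρle : ∀ q ∈ A, 2 * (ψ q / (2 * q)) ≤ 1 / q := fun q hq => by
    have h2 : (0 : ℝ) < q := by exact_mod_cast hA q hq
    have h3 : 2 * (ψ q / (2 * q)) = ψ q / q := by field_simp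
    rw [h3]
    exact div_le_div_of_nonneg_right ((le_abs_self _).trans (hψ q)) h2.le
  have hEm : ∀ q, MeasurableSet (E q) := fun q => by
    by_cases hq : q ∈ A
    · rw [hEA q hq]
      exact measurableSet_primitiveNeighbourhood _ _ _
    · rw [hEA' q hq]
      exact MeasurableSet.empty
  have hEsub : ∀ q, E q ⊆ ball 0 2 := fun q => by
    by_cases hq : q ∈ A
    · rw [hEA q hq]
      refine iUnion₂_subset fun p hp => ball_subset_ball' ?_
      have h2 : (1 : ℝ) ≤ q := by exact_mod_cast hA q hq
      have h3 : (1 : ℝ) / q ≤ 1 := (div_le_one (by linarith)).2 h2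
      have h4 : dist (fun i => (p i : ℝ) / q) 0 ≤ 1 := by
        rw [dist_pi_le_iff zero_le_one]
        intro i
        have h5 : (p i : ℝ) ≤ q := by exact_mod_cast ((mem_primitiveVectors.1 hp).1 i).le
        rw [Pi.zero_apply, dist_zero_right, Real.norm_of_nonneg (by positivity)]
        exact (div_le_one (by linarith)).2 h5
      have := hρle q hq
      linarith
    · rw [hEA' q hq]
      exact empty_subset _
  set μ : Measure (Fin k → ℝ) := volume.restrict (ball 0 2) with hμ
  have : IsFiniteMeasure μ := ⟨by
    rw [hμ, Measure.restrict_apply_univ]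
    exact measure_ball_lt_top⟩
  have hμE : ∀ q ∈ A, ψ q ^ k / 4 ≤ μ.real (E q) := fun q hq => by
    have h1 := le_volume_primitiveNeighbourhood hk (hA q hq) (hρ q hq) (hρle q hq)
    have h2 : μ (E q) = volume (E q) := by
      rw [hμ, Measure.restrict_apply (hEm q), inter_eq_left.2 (hEsub q)]
    rw [hqρ q hq, mul_div_cancel₀ _ two_ne_zero, ← hEA q hq, ← h2] at h1
    exact (ENNReal.ofReal_le_iff_le_toReal (measure_ne_top _ _)).1 h1
  -- The `3` is `12 / (2 · 2)` from the halved radii; the `16` undoes the two density losses of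
  -- `1/4`.
  have hquasi : ∀ q r, q ≠ r →
      μ.real (E q ∩ E r) ≤ 16 * 3 ^ k * (μ.real (E q) * μ.real (E r)) := by
    intro q r hqr
    by_cases hq : q ∈ A
    swap
    · rw [hEA' q hq]
      simp
    by_cases hr : r ∈ A
    swap
    · rw [hEA' r hr]
      simp
    have h1 := volume_inter_primitiveNeighbourhood_le (k := k) (hA q hq) (hA r hr) hqr
      (hρ q hq) (hρ r hr)
    rw [hqρ q hq, hqρ r hr, ← hEA q hq, ← hEA r hr] at h1
    have h0q := hpos q hq
    have h0r := hpos r hr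
    have h2 : μ.real (E q ∩ E r) ≤ (12 * (ψ q / 2) * (ψ r / 2)) ^ k :=
      ENNReal.toReal_le_of_le_ofReal (by positivity) ((Measure.restrict_apply_le _ _).trans h1)
    have h3 : (12 * (ψ q / 2) * (ψ r / 2)) ^ k = 16 * 3 ^ k * (ψ q ^ k / 4 * (ψ r ^ k / 4)) := by
      have : 12 * (ψ q / 2) * (ψ r / 2) = 3 * ψ q * ψ r := by ring
      rw [this, mul_pow, mul_pow]
      ring
    rw [h3] at h2
    refine h2.trans (mul_le_mul_of_nonneg_left ?_ (by positivity))
    exact mul_le_mul (hμE q hq) (hμE r hr) (by positivity) measureReal_nonneg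
  have hns : ¬ Summable fun q => μ.real (E q) := by
    intro hs
    refine hdiv (Summable.of_nonneg_of_le (fun q => ?_) (fun q => ?_) (hs.mul_left 4))
    · exact indicator_nonneg (fun q hq => pow_nonneg (hpos q hq).le _) q
    · by_cases hq : q ∈ A
      · rw [indicator_of_mem hq]
        have := hμE q hq
        linarith
      · rw [indicator_of_notMem hq]
        have : 0 ≤ μ.real (E q) := measureReal_nonneg
        linarith
  have hlim := measure_limsup_pos_of_quasiIndependent μ hEm (by positivity) hquasi hns
  refine ((hlim.trans_le (Measure.restrict_apply_le _ _)).trans_le (measure_mono ?_)).ne'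
  intro y hy
  refine (mem_limsup_iff_frequently_mem.1 hy).mono fun q hq => ?_
  by_cases hqA : q ∈ A
  · exact ⟨hqA, hEA q hqA ▸ hq⟩
  · rw [hEA' q hqA] at hq
    exact absurd hq (notMem_empty y)

/-- **Gallagher's theorem**: in dimension `k ≥ 2`, if `∑_{q ∈ A} ψ(q)^k` diverges then almost every
point of `ℝ^k` is `ψ`-approximable by rational vectors with denominators in `A`. No monotonicity is
assumed. -/
theorem ae_frequently_approximable {k : ℕ} (hk : 2 ≤ k) {A : Set ℕ}
    {ψ : ℕ → ℝ} (hA : ∀ q ∈ A, 0 < q) (hpos : ∀ q ∈ A, 0 < ψ q) (hψ : ∀ q, |ψ q| ≤ 1)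
    (hdiv : ¬ Summable (A.indicator fun q => ψ q ^ k)) :
    ∀ᵐ y : Fin k → ℝ, ∃ᶠ q in atTop, q ∈ A ∧ ∃ p : Fin k → ℤ, ∀ i, |q * y i - p i| < ψ q := by
  set W : ℝ → Set (Fin k → ℝ) := fun c =>
    blimsup (fun q : ℕ => thickening (c * (ψ q / q)) (rationalGrid k q)) atTop (· ∈ A) with hW
  have hmem : ∀ {c : ℝ}, 0 < c → ∀ y, y ∈ W c ↔
      ∃ᶠ q in atTop, q ∈ A ∧ ∃ p : Fin k → ℤ, ∀ i, |q * y i - p i| < c * ψ q := by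
    intro c hc y
    rw [hW, mem_blimsup_iff_frequently]
    refine frequently_congr (Eventually.of_forall fun q => and_congr_right fun hq => ?_)
    exact mem_thickening_rationalGrid (hA q hq) (mul_pos hc (hpos q hq))
  have hr : Tendsto (fun q : ℕ => ψ q / q) atTop (𝓝 0) := by
    refine squeeze_zero_norm (fun q => ?_) tendsto_one_div_atTop_nhds_zero_nat
    rw [norm_div, Real.norm_eq_abs, Real.norm_natCast]
    exact div_le_div_of_nonneg_right (hψ q) (by positivity)
  -- Cassels' lemma: multiplying the radii by a positive constant changes the limsup set only by a
  -- null set. The union `S` over all constants can then replace `W 1`, and unlike `W 1` it is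
  -- visibly stable under doubling.
  have hWae : ∀ n : ℕ, W (n + 1) =ᵐ[volume] W 1 := by
    intro n
    have h1 := blimsup_thickening_mul_ae_eq (volume : Measure (Fin k → ℝ)) (· ∈ A)
      (rationalGrid k) (by positivity : (0 : ℝ) < n + 1) _ hr
    have h2 := blimsup_thickening_mul_ae_eq (volume : Measure (Fin k → ℝ)) (· ∈ A)
      (rationalGrid k) one_pos _ hr
    exact h1.trans h2.symm
  set S := ⋃ n : ℕ, W (n + 1) with hS
  have hSm : MeasurableSet S := MeasurableSet.iUnion fun n =>
    MeasurableSet.measurableSet_blimsup fun q _ => isOpen_thickening.measurableSet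
  have hfull : ∀ᵐ y, y ∈ S := by
    refine ae_mem_of_int_translation_of_two_smul hSm ?_ ?_ ?_
    · intro y hy m
      obtain ⟨n, hn⟩ := mem_iUnion.1 hy
      refine mem_iUnion.2 ⟨n, ?_⟩
      rw [hmem (by positivity)] at hn ⊢
      refine hn.mono fun q ⟨hq, p, hp⟩ => ⟨hq, fun i => p i + q * m i, fun i => ?_⟩
      convert hp i using 2
      push_cast
      ring
    · intro y hy
      obtain ⟨n, hn⟩ := mem_iUnion.1 hy
      -- Doubling `y` doubles the error, and `2 (n + 1) = (2n + 1) + 1`.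
      refine mem_iUnion.2 ⟨2 * n + 1, ?_⟩
      rw [hmem (by positivity)] at hn ⊢
      refine hn.mono fun q ⟨hq, p, hp⟩ => ⟨hq, fun i => 2 * p i, fun i => ?_⟩
      have h1 : q * ((2 : ℝ) • y) i - ((2 * p i : ℤ) : ℝ) = 2 * (q * y i - p i) := by
        simp only [Pi.smul_apply, smul_eq_mul]
        push_cast
        ring
      rw [h1, abs_mul, abs_two]
      push_cast
      have := hp i
      linarith
    · have h1 := volume_limsup_primitiveNeighbourhood_ne_zero hk hA hpos hψ hdiv
      refine fun h => h1 (measure_mono_null ?_ h)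
      intro y hy
      refine mem_iUnion.2 ⟨0, ?_⟩
      rw [Nat.cast_zero, zero_add, hW, mem_blimsup_iff_frequently]
      refine hy.mono fun q ⟨hq, hyq⟩ => ⟨hq, ?_⟩
      obtain ⟨p, -, hp⟩ := mem_iUnion₂.1 hyq
      refine mem_thickening_iff.2 ⟨_, ⟨fun i => (p i : ℤ), rfl⟩, ?_⟩
      simp only [Int.cast_natCast]
      refine (mem_ball.1 hp).trans_le ?_
      have h2 : (0 : ℝ) < q := by exact_mod_cast hA q hq
      have h3 := hpos q hq
      rw [one_mul]
      exact div_le_div_of_nonneg_left h3.le h2 (by linarith)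
  have hall : ∀ᵐ y, ∀ n : ℕ, (y ∈ W (n + 1) ↔ y ∈ W 1) :=
    ae_all_iff.2 fun n => (hWae n).mem_iff
  filter_upwards [hfull, hall] with y hy hy'
  obtain ⟨n, hn⟩ := mem_iUnion.1 hy
  simpa only [one_mul] using (hmem one_pos y).1 ((hy' n).1 hn)

/-! ### Pigeonhole and dyadic summation. -/

/-- Pigeonhole lower bound for the number of `q ≤ N` for which `q x` is close to an integer. -/
theorem le_card_near_int (x : ℝ) {δ : ℝ} (hδ : 0 < δ) (hδ1 : δ ≤ 1) (N : ℕ) :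
    N * δ / 2 - 1 ≤ ∑ q ∈ Finset.Icc 1 N,
      {q : ℕ | ∃ p : ℤ, |q * x - p| < δ}.indicator (fun _ => (1 : ℝ)) q := by
  classical
  set B := {q : ℕ | ∃ p : ℤ, |q * x - p| < δ} with hB
  set M := ⌈1 / δ⌉₊ with hM
  have hM1 : 1 / δ ≤ M := Nat.le_ceil _
  have hM2 : (M : ℝ) < 1 / δ + 1 := Nat.ceil_lt_add_one (by positivity)
  have hM0 : (0 : ℝ) < M := lt_of_lt_of_le (by positivity) hM1
  have hMN : M ≠ 0 := by exact_mod_cast hM0.ne'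
  have hMδ : M * δ ≤ 2 := by
    have : (M : ℝ) * δ ≤ (1 / δ + 1) * δ := mul_le_mul_of_nonneg_right hM2.le hδ.le
    rw [add_mul, one_div_mul_cancel hδ.ne'] at this
    linarith
  obtain ⟨b, -, hb⟩ := Finset.exists_le_card_fiber_of_nsmul_le_card_of_maps_to
    (s := Finset.range (N + 1)) (t := Finset.range M)
    (f := fun q : ℕ => ⌊Int.fract (q * x) * M⌋₊) (b := ((N : ℝ) + 1) / M)
    (fun q _ => by
      rw [Finset.mem_range, Nat.floor_lt (mul_nonneg (Int.fract_nonneg _) hM0.le)]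
      have := Int.fract_lt_one (q * x)
      nlinarith)
    (Finset.nonempty_range_iff.2 hMN)
    (by
      rw [Finset.card_range, Finset.card_range, nsmul_eq_mul, mul_div_cancel₀ _ hM0.ne']
      push_cast
      exact le_rfl)
  set F := (Finset.range (N + 1)).filter fun q : ℕ => ⌊Int.fract (q * x) * M⌋₊ = b with hF
  have hFne : F.Nonempty := by
    rw [← Finset.card_pos]
    have : (0 : ℝ) < F.card := lt_of_lt_of_le (by positivity) hb
    exact_mod_cast this
  -- Differences `q - m` within the fullest box lie in `[1, N]` and have `(q - m) x` within `1/M ≤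
  -- δ` of an integer; only `q = m` is lost.
  set m := F.min' hFne with hm
  have hmF : m ∈ F := F.min'_mem hFne
  have hinj : (F.erase m).card ≤ ((Finset.Icc 1 N).filter (· ∈ B)).card := by
    refine Finset.card_le_card_of_injOn (fun q => q - m) ?_ ?_
    · intro q hq
      have hq' := Finset.mem_erase.1 (Finset.mem_coe.1 hq)
      have hmq : m ≤ q := F.min'_le q hq'.2
      have hqF := Finset.mem_filter.1 hq'.2
      have hmF' := Finset.mem_filter.1 hmF
      have hqN := Finset.mem_range.1 hqF.1
      have hne := hq'.1
      rw [Finset.mem_coe, Finset.mem_filter, Finset.mem_Icc]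
      have hlow : 1 ≤ q - m := by omega
      have hup : q - m ≤ N := by omega
      refine ⟨⟨hlow, hup⟩, ⌊q * x⌋ - ⌊m * x⌋, ?_⟩
      have e1 : ((q - m : ℕ) : ℝ) * x - ((⌊q * x⌋ - ⌊m * x⌋ : ℤ) : ℝ) =
          Int.fract (q * x) - Int.fract (m * x) := by
        rw [Int.fract, Int.fract, Nat.cast_sub hmq]
        push_cast
        ring
      rw [e1]
      have h1 := Nat.floor_le (mul_nonneg (Int.fract_nonneg (q * x)) hM0.le)
      have h2 := Nat.lt_floor_add_one (Int.fract (q * x) * M)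
      have h3 := Nat.floor_le (mul_nonneg (Int.fract_nonneg (m * x)) hM0.le)
      have h4 := Nat.lt_floor_add_one (Int.fract (m * x) * M)
      rw [hqF.2] at h1 h2
      rw [hmF'.2] at h3 h4
      have h5 : |Int.fract (q * x) - Int.fract (m * x)| * M < 1 := by
        have h6 : |(Int.fract (q * x) - Int.fract (m * x)) * M| < 1 := by
          rw [sub_mul, abs_lt]
          constructor <;> linarith
        rwa [abs_mul, abs_of_pos hM0] at h6
      have h6 : 1 ≤ δ * M := by
        rwa [div_le_iff₀ hδ, mul_comm] at hM1
      exact lt_of_mul_lt_mul_right (h5.trans_le h6) hM0.le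
    · intro q hq e he hqe
      have h1 := F.min'_le q (Finset.mem_erase.1 (Finset.mem_coe.1 hq)).2
      have h2 := F.min'_le e (Finset.mem_erase.1 (Finset.mem_coe.1 he)).2
      simp only at hqe
      omega
  have hcard : ∑ q ∈ Finset.Icc 1 N, B.indicator (fun _ => (1 : ℝ)) q =
      ((Finset.Icc 1 N).filter (· ∈ B)).card := by
    rw [Finset.card_filter]
    push_cast
    exact Finset.sum_congr rfl fun q _ => by simp [indicator_apply]
  rw [hcard]
  rw [Finset.card_erase_of_mem hmF] at hinj
  have h7 : (F.card : ℝ) - 1 ≤ ((Finset.Icc 1 N).filter (· ∈ B)).card := by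
    have : F.card ≤ ((Finset.Icc 1 N).filter (· ∈ B)).card + 1 := by omega
    have : (F.card : ℝ) ≤ ((Finset.Icc 1 N).filter (· ∈ B)).card + 1 := by exact_mod_cast this
    linarith
  have h8 : N * δ / 2 ≤ ((N : ℝ) + 1) / M := by
    rw [le_div_iff₀ hM0]
    have : (0 : ℝ) ≤ N := by positivity
    nlinarith
  linarith

/-- Dyadic summation by parts for a nonincreasing weight. -/
theorem dyadic_sum_le_sum_indicator {φ : ℕ → ℝ} (hφ : AntitoneOn φ (Ici 2)) (A : Set ℕ) (J : ℕ) :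
    ∑ j ∈ Finset.range J, (φ (2 ^ (j + 1)) - φ (2 ^ (j + 2))) *
        ∑ q ∈ Finset.Icc 2 (2 ^ (j + 1)), A.indicator (fun _ => (1 : ℝ)) q +
      φ (2 ^ (J + 1)) * ∑ q ∈ Finset.Icc 2 (2 ^ J), A.indicator (fun _ => (1 : ℝ)) q ≤
    ∑ q ∈ Finset.Icc 2 (2 ^ J), A.indicator φ q := by
  induction J with
  | zero => simp
  | succ J ih =>
    have hsplit : ∀ f : ℕ → ℝ, ∑ q ∈ Finset.Icc 2 (2 ^ (J + 1)), f q =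
        ∑ q ∈ Finset.Icc 2 (2 ^ J), f q +
          ∑ q ∈ (Finset.Icc 2 (2 ^ (J + 1))).filter (2 ^ J < ·), f q := by
      intro f
      refine (Finset.sum_filter_add_sum_filter_not _ (2 ^ J < ·) f).symm.trans
        ((add_comm _ _).trans (congrArg (· + _) (Finset.sum_congr ?_ fun _ _ => rfl)))
      ext q
      have : 2 ^ (J + 1) = 2 * 2 ^ J := pow_succ' _ _
      simp only [Finset.mem_filter, Finset.mem_Icc]
      omega
    -- The boundary weight stands one dyadic step ahead, so the new summand and the new boundary
    -- term collapse to `φ(2^(J+1))` times the full count. Only the new block needs an estimate, by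
    -- monotonicity.
    have hnew : φ (2 ^ (J + 1)) * ∑ q ∈ (Finset.Icc 2 (2 ^ (J + 1))).filter (2 ^ J < ·),
        A.indicator (fun _ => (1 : ℝ)) q ≤
        ∑ q ∈ (Finset.Icc 2 (2 ^ (J + 1))).filter (2 ^ J < ·), A.indicator φ q := by
      rw [Finset.mul_sum]
      refine Finset.sum_le_sum fun q hq => ?_
      have hq' := Finset.mem_Icc.1 (Finset.mem_filter.1 hq).1
      by_cases h : q ∈ A
      · rw [indicator_of_mem h, indicator_of_mem h, mul_one]
        exact hφ hq'.1 (hq'.1.trans hq'.2) hq'.2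
      · rw [indicator_of_notMem h, indicator_of_notMem h, mul_zero]
    rw [Finset.sum_range_succ, hsplit (A.indicator φ)]
    have h1 := hsplit (A.indicator fun _ => (1 : ℝ))
    have h2 : φ (2 ^ (J + 1)) * ∑ q ∈ Finset.Icc 2 (2 ^ (J + 1)),
        A.indicator (fun _ => (1 : ℝ)) q =
        φ (2 ^ (J + 1)) * ∑ q ∈ Finset.Icc 2 (2 ^ J), A.indicator (fun _ => (1 : ℝ)) q +
        φ (2 ^ (J + 1)) * ∑ q ∈ (Finset.Icc 2 (2 ^ (J + 1))).filter (2 ^ J < ·),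
        A.indicator (fun _ => (1 : ℝ)) q := by rw [h1, mul_add]
    rw [sub_mul]
    linarith

/-! ### The function `ψ` and divergence along the good denominators. -/

theorem mul_log_natCast_ge_one {q : ℕ} (hq : 2 ≤ q) : 1 ≤ (q : ℝ) * Real.log q := by
  have h2 : (2 : ℝ) ≤ q := by exact_mod_cast hq
  have h3 : Real.log 2 ≤ Real.log q := Real.log_le_log (by norm_num) h2
  have h4 := Real.log_two_gt_d9
  nlinarith

theorem prototypePsi_pos (d : ℕ) {q : ℕ} (hq : 2 ≤ q) : 0 < prototypePsi d q :=
  Real.rpow_pos_of_pos (zero_lt_one.trans_le (mul_log_natCast_ge_one hq)) _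

theorem neg_one_div_natCast_nonpos (d : ℕ) : -(1 : ℝ) / d ≤ 0 :=
  div_nonpos_of_nonpos_of_nonneg (by norm_num) (by positivity)

theorem prototypePsi_antitoneOn (d : ℕ) : AntitoneOn (prototypePsi d) (Ici 2) := by
  intro q hq r _ hqr
  have h2 : (2 : ℝ) ≤ q := by exact_mod_cast (mem_Ici.1 hq)
  have h3 : (q : ℝ) ≤ r := by exact_mod_cast hqr
  refine Real.rpow_le_rpow_of_nonpos (zero_lt_one.trans_le (mul_log_natCast_ge_one hq)) ?_
    (neg_one_div_natCast_nonpos d)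
  exact mul_le_mul h3 (Real.log_le_log (by linarith) h3) (Real.log_nonneg (by linarith))
    (by linarith)

theorem abs_prototypePsi_le_one (d q : ℕ) : |prototypePsi d q| ≤ 1 := by
  rcases lt_or_ge q 2 with h | h
  -- For `q ≤ 1` the value is a power of `0`: it is `0` for `d ≥ 1`, and `1` for `d = 0` because the
  -- exponent `-1/0` is then `0`.
  · have h0 : (q : ℝ) * Real.log q = 0 := by
      interval_cases q <;> simp
    rw [prototypePsi, h0, abs_of_nonneg (Real.rpow_nonneg le_rfl _)]
    exact Real.zero_rpow_le_one _
  · rw [abs_of_pos (prototypePsi_pos d h)]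
    exact Real.rpow_le_one_of_one_le_of_nonpos (mul_log_natCast_ge_one h)
      (neg_one_div_natCast_nonpos d)

theorem prototypePsi_pow {d : ℕ} (hd : d ≠ 0) {q : ℕ} (hq : 2 ≤ q) :
    prototypePsi d q ^ d = ((q : ℝ) * Real.log q)⁻¹ := by
  have h0 : (0 : ℝ) ≤ (q : ℝ) * Real.log q := zero_le_one.trans (mul_log_natCast_ge_one hq)
  have hd' : (d : ℝ) ≠ 0 := by exact_mod_cast hd
  rw [prototypePsi, ← Real.rpow_natCast, ← Real.rpow_mul h0, div_mul_cancel₀ _ hd',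
    Real.rpow_neg_one]

theorem prototypePsi_two_mul_le (d : ℕ) {q : ℕ} (hq : 2 ≤ q) :
    prototypePsi d (2 * q) ≤ (2 : ℝ) ^ (-(1 : ℝ) / d) * prototypePsi d q := by
  have h2 : (2 : ℝ) ≤ q := by exact_mod_cast hq
  have h1 := mul_log_natCast_ge_one hq
  rw [prototypePsi, prototypePsi, ← Real.mul_rpow (by norm_num) (by linarith)]
  refine Real.rpow_le_rpow_of_nonpos (by linarith) ?_ (neg_one_div_natCast_nonpos d)
  push_cast
  rw [mul_assoc]
  have : Real.log q ≤ Real.log (2 * q) := Real.log_le_log (by linarith) (by linarith)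
  nlinarith

/-- The denominators `q ≥ 2` for which `q x` is within `ψ q` of an integer. -/
def goodDenominators (ψ : ℕ → ℝ) (x : ℝ) : Set ℕ :=
  {q | 2 ≤ q ∧ ∃ p : ℤ, |q * x - p| < ψ q}

/-- Pigeonhole with `δ = ψ(N)`, which is at most `ψ(q)` for `2 ≤ q ≤ N`. The loss is `2` instead of
`1` because `q = 1` is discarded. -/
theorem le_card_goodDenominators {ψ : ℕ → ℝ} (hanti : AntitoneOn ψ (Ici 2)) (x : ℝ) {N : ℕ}
    (hN : 2 ≤ N) (h0 : 0 < ψ N) (h1 : ψ N ≤ 1) :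
    N * ψ N / 2 - 2 ≤
      ∑ q ∈ Finset.Icc 2 N, (goodDenominators ψ x).indicator (fun _ => (1 : ℝ)) q := by
  have h := le_card_near_int x h0 h1 N
  rw [← Finset.add_sum_Ioc_eq_sum_Icc (by omega)] at h
  have hIoc : Finset.Ioc 1 N = Finset.Icc 2 N := rfl
  rw [hIoc] at h
  have hone : {q : ℕ | ∃ p : ℤ, |q * x - p| < ψ N}.indicator (fun _ => (1 : ℝ)) 1 ≤ 1 :=
    indicator_le_self' (fun _ _ => zero_le_one) _
  have hsum : ∑ q ∈ Finset.Icc 2 N,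
      {q : ℕ | ∃ p : ℤ, |q * x - p| < ψ N}.indicator (fun _ => (1 : ℝ)) q ≤
      ∑ q ∈ Finset.Icc 2 N, (goodDenominators ψ x).indicator (fun _ => (1 : ℝ)) q := by
    refine Finset.sum_le_sum fun q hq => ?_
    have hq' := Finset.mem_Icc.1 hq
    by_cases hqB : q ∈ {q : ℕ | ∃ p : ℤ, |q * x - p| < ψ N}
    · rw [indicator_of_mem hqB, indicator_of_mem]
      obtain ⟨p, hp⟩ := hqB
      exact ⟨hq'.1, p, hp.trans_le (hanti hq'.1 hN hq'.2)⟩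
    · rw [indicator_of_notMem hqB]
      exact indicator_nonneg (fun _ _ => zero_le_one) _
  linarith

theorem not_summable_goodDenominators {d : ℕ} (hd : 2 ≤ d) (x : ℝ) :
    ¬ Summable ((goodDenominators (prototypePsi d) x).indicator
      fun q => prototypePsi d q ^ (d - 1)) := by
  intro hsum
  set ψ := prototypePsi d with hψ
  set A := goodDenominators ψ x with hA
  set φ : ℕ → ℝ := fun q => ψ q ^ (d - 1) with hφ
  set β : ℝ := (2 : ℝ) ^ (-(1 : ℝ) / d) with hβ
  have hdR : (0 : ℝ) < d := by exact_mod_cast (by omega : 0 < d)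
  have hβ0 : 0 < β := Real.rpow_pos_of_pos (by norm_num) _
  have hβ1 : β < 1 := Real.rpow_lt_one_of_one_lt_of_neg (by norm_num)
    (div_neg_of_neg_of_pos (by norm_num) hdR)
  have hpow2 : ∀ j : ℕ, 2 ≤ 2 ^ (j + 1) := fun j => by
    rw [pow_succ']
    have := Nat.one_le_two_pow (n := j)
    omega
  have hψpos : ∀ q, 2 ≤ q → 0 < ψ q := fun q hq => prototypePsi_pos d hq
  have hψanti : AntitoneOn ψ (Ici 2) := prototypePsi_antitoneOn d
  have hφanti : AntitoneOn φ (Ici 2) := fun q hq r hr hqr =>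
    pow_le_pow_left₀ (hψpos r hr).le (hψanti hq hr hqr) _
  have hφ0 : ∀ q ∈ A, 0 ≤ φ q := fun q hq => pow_nonneg (hψpos q hq.1).le _
  have hdecay : ∀ j : ℕ, φ (2 ^ (j + 2)) ≤ β * φ (2 ^ (j + 1)) := by
    intro j
    have h1 : ψ (2 ^ (j + 2)) ≤ β * ψ (2 ^ (j + 1)) := by
      have := prototypePsi_two_mul_le d (hpow2 j)
      rwa [← pow_succ'] at this
    calc φ (2 ^ (j + 2)) ≤ (β * ψ (2 ^ (j + 1))) ^ (d - 1) :=
          pow_le_pow_left₀ (hψpos _ (hpow2 (j + 1))).le h1 _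
      _ = β ^ (d - 1) * φ (2 ^ (j + 1)) := mul_pow _ _ _
      _ ≤ β * φ (2 ^ (j + 1)) := by
          refine mul_le_mul_of_nonneg_right ?_ (pow_nonneg (hψpos _ (hpow2 j)).le _)
          exact pow_le_of_le_one hβ0.le hβ1.le (by omega)
  -- The main term uses `2^(j+1) ψ(2^(j+1))^d = 1 / ((j+1) log 2)`. The error is kept as a
  -- difference of consecutive `φ` values, so that it telescopes to at most `2 φ(2)`.
  have hterm : ∀ j : ℕ, (1 - β) / (2 * Real.log 2) * (1 / ((j : ℝ) + 1)) -
      2 * (φ (2 ^ (j + 1)) - φ (2 ^ (j + 2))) ≤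
      (φ (2 ^ (j + 1)) - φ (2 ^ (j + 2))) *
        ∑ q ∈ Finset.Icc 2 (2 ^ (j + 1)), A.indicator (fun _ => (1 : ℝ)) q := by
    intro j
    have h1 := le_card_goodDenominators hψanti x (hpow2 j) (hψpos _ (hpow2 j))
      ((le_abs_self _).trans (abs_prototypePsi_le_one d _))
    have hφj : 0 ≤ φ (2 ^ (j + 1)) := pow_nonneg (hψpos _ (hpow2 j)).le _
    have h2 : (1 - β) * φ (2 ^ (j + 1)) ≤ φ (2 ^ (j + 1)) - φ (2 ^ (j + 2)) := by
      have := hdecay j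
      linarith
    have h3 : 0 ≤ φ (2 ^ (j + 1)) - φ (2 ^ (j + 2)) :=
      (mul_nonneg (by linarith) hφj).trans h2
    refine le_trans ?_ (mul_le_mul_of_nonneg_left h1 h3)
    have h4 : φ (2 ^ (j + 1)) * (((2 ^ (j + 1) : ℕ) : ℝ) * ψ (2 ^ (j + 1))) =
        1 / (((j : ℝ) + 1) * Real.log 2) := by
      have h5 : φ (2 ^ (j + 1)) * ψ (2 ^ (j + 1)) = ψ (2 ^ (j + 1)) ^ d := by
        rw [hφ, ← pow_succ]
        congr 1
        omega
      have h6 := prototypePsi_pow (by omega : d ≠ 0) (hpow2 j)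
      rw [mul_left_comm, h5, hψ, h6]
      push_cast
      rw [Real.log_pow]
      push_cast
      have := Real.log_pos (by norm_num : (1 : ℝ) < 2)
      field_simp
    have h7 : (1 - β) / (2 * Real.log 2) * (1 / ((j : ℝ) + 1)) =
        (1 - β) * φ (2 ^ (j + 1)) * (((2 ^ (j + 1) : ℕ) : ℝ) * ψ (2 ^ (j + 1)) / 2) := by
      have h8 : (1 - β) * φ (2 ^ (j + 1)) * (((2 ^ (j + 1) : ℕ) : ℝ) * ψ (2 ^ (j + 1)) / 2) =
        (1 - β) / 2 * (φ (2 ^ (j + 1)) * (((2 ^ (j + 1) : ℕ) : ℝ) * ψ (2 ^ (j + 1)))) := by ring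
      rw [h8, h4]
      have := Real.log_pos (by norm_num : (1 : ℝ) < 2)
      field_simp
    rw [h7, mul_sub]
    have h9 : 0 ≤ ((2 ^ (j + 1) : ℕ) : ℝ) * ψ (2 ^ (j + 1)) / 2 := by
      have := hψpos _ (hpow2 j)
      positivity
    have := mul_le_mul_of_nonneg_right h2 h9
    linarith
  have hbound : ∀ J : ℕ, (1 - β) / (2 * Real.log 2) *
      ∑ j ∈ Finset.range J, 1 / ((j : ℝ) + 1) ≤ 2 * φ 2 + ∑' q, A.indicator φ q := by
    intro J
    have h1 := dyadic_sum_le_sum_indicator hφanti A J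
    have h2 := Finset.sum_le_sum fun j (_ : j ∈ Finset.range J) => hterm j
    rw [Finset.sum_sub_distrib, ← Finset.mul_sum, ← Finset.mul_sum] at h2
    have h3 := Finset.sum_range_sub' (fun j => φ (2 ^ (j + 1))) J
    have h4 : ∑ q ∈ Finset.Icc 2 (2 ^ J), A.indicator φ q ≤ ∑' q, A.indicator φ q :=
      hsum.sum_le_tsum _ fun q _ => indicator_nonneg hφ0 q
    have h5 : 0 ≤ φ (2 ^ (J + 1)) := pow_nonneg (hψpos _ (hpow2 J)).le _
    have h6 : 0 ≤ φ (2 ^ (J + 1)) *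
        ∑ q ∈ Finset.Icc 2 (2 ^ J), A.indicator (fun _ => (1 : ℝ)) q :=
      mul_nonneg h5 (Finset.sum_nonneg fun q _ => indicator_nonneg (fun _ _ => zero_le_one) q)
    simp only [zero_add, pow_one, add_assoc, Nat.reduceAdd] at h3
    rw [h3] at h2
    linarith
  have hκ : 0 < (1 - β) / (2 * Real.log 2) :=
    div_pos (by linarith) (mul_pos (by norm_num) (Real.log_pos (by norm_num)))
  have htend := Real.tendsto_sum_range_one_div_nat_succ_atTop.const_mul_atTop hκ
  obtain ⟨J, hJ⟩ := (htend.eventually_gt_atTop (2 * φ 2 + ∑' q, A.indicator φ q)).exists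
  exact absurd (hbound J) (not_le.2 hJ)

theorem theorem1 (d : ℕ) (hd : 3 ≤ d) (x : ℝ) :
    ∀ᵐ y : Fin (d - 1) → ℝ ∂MeasureTheory.volume,
      fiberPoint x y ∈ approximableVectors d (prototypePsi d) := by
  have hmain := ae_frequently_approximable (k := d - 1) (by omega)
    (A := goodDenominators (prototypePsi d) x) (ψ := prototypePsi d)
    (fun q hq => zero_lt_two.trans_le hq.1) (fun q hq => prototypePsi_pos d hq.1)
    (abs_prototypePsi_le_one d) (not_summable_goodDenominators (by omega) x)
  filter_upwards [hmain] with y hy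
  -- Infinitely many denominators already give infinitely many pairs.
  refine Set.Infinite.of_image Prod.snd ((Nat.frequently_atTop_iff_infinite.1 hy).mono ?_)
  rintro q ⟨⟨hq, p₀, hp₀⟩, p, hp⟩
  refine ⟨(fun i => if h : i.val = 0 then p₀ else p ⟨i.val - 1, by have := i.isLt; omega⟩, q),
    ⟨by omega, ?_⟩, rfl⟩
  rw [pi_norm_lt_iff (prototypePsi_pos d hq)]
  intro i
  rw [Real.norm_eq_abs]
  by_cases h : i.val = 0
  · simpa [fiberPoint, h] using hp₀
  · simpa [fiberPoint, h] using hp ⟨i.val - 1, by have := i.isLt; omega⟩
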